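/- A polyhedron in $\mathbb{R}^n$ is a nonempty set of the form $\{x \in \mathbb{R}^n : Ax \le b\}$ with finitely many inequalities. A polyhedron $P$ is called box-integer if, for all integer vectors $l, u \in \mathbb{Z}^n$ with $l \le u$, the set $P \cap \{x \in \mathbb{R}^n : l \le x \le u\}$ is the (possibly empty) convex hull of the integer points that it contains. A polyhedral cone is a polyhedron $C$ such that $\lambda d \in C$ for all $d \in C$ and all $\lambda \ge 0$. Theorem. Every box-integer polyhedron $P \subseteq \mathbb{R}^n$ can be represented as a Minkowski sum $P = Q + C = \{x + y : x \in Q,\ y \in C\}$, where $Q$ is a bounded box-integer polyhedron, $C$ is a box-integer polyhedral cone, and $C$ is the characteristic cone $\{d \in \mathbb{R}^n : x + d \in P \text{ for all } x \in P\}$ of $P$. -/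

import Mathlib

open scoped Pointwise

namespace Polyhedra

/-- `P ⊆ ℝⁿ` is the solution set `{x | A x ≤ b}` of a finite system of linear inequalities
(nonemptiness is stated separately where it is needed). -/
def IsPolyhedron {n : ℕ} (P : Set (Fin n → ℝ)) : Prop :=
  ∃ (m : ℕ) (A : Matrix (Fin m) (Fin n) ℝ) (b : Fin m → ℝ),
    P = {x : Fin n → ℝ | A.mulVec x ≤ b}

/-- The real vector with the same entries as an integer vector. -/
def toReal {n : ℕ} (z : Fin n → ℤ) : Fin n → ℝ := fun i => (z i : ℝ)

/-- The set `ℤⁿ` of integer points of `ℝⁿ`. -/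
def integerPoints (n : ℕ) : Set (Fin n → ℝ) := Set.range (toReal (n := n))

/-- A polyhedron that is the convex hull of its integer points (the empty set included). -/
def IsIntegerPolyhedron {n : ℕ} (P : Set (Fin n → ℝ)) : Prop :=
  IsPolyhedron P ∧ P = convexHull ℝ (P ∩ integerPoints n)

/-- A polyhedron whose intersection with every integral box `{x | l ≤ x ≤ u}` is an integer
polyhedron. -/
def IsBoxIntegerPolyhedron {n : ℕ} (P : Set (Fin n → ℝ)) : Prop :=
  IsPolyhedron P ∧
    ∀ l u : Fin n → ℤ, l ≤ u → IsIntegerPolyhedron (P ∩ Set.Icc (toReal l) (toReal u))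

/-- `C` is closed under multiplication by nonnegative reals. -/
def IsCone {n : ℕ} (C : Set (Fin n → ℝ)) : Prop :=
  ∀ d ∈ C, ∀ t : ℝ, 0 ≤ t → t • d ∈ C

/-- The characteristic (recession) cone `{d | x + d ∈ P for all x ∈ P}`. -/
def charCone {n : ℕ} (P : Set (Fin n → ℝ)) : Set (Fin n → ℝ) :=
  {d | ∀ x ∈ P, x + d ∈ P}

end Polyhedra

namespace Polyhedra

/-! Any polyhedron splits with remainders of bounded norm (`exists_bounded_remainder`), so Q can be
P cut by a large integral cube, which inherits box-integrality. The substance is box-integrality of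
the recession cone C. Let v be a vertex of C ∩ [l, u]. Maximising over P the constraints tight at v
gives a face F with F + v ⊆ F, and F contains an integer point w. Box-integrality at w + v,
translated by -w, puts v in the hull of integer points of [l, u] satisfying those tight equations
(`mem_convexHull_of_boxIntegral`). Near v this set agrees with C ∩ [l, u] up to non-tight
constraints, so v is a vertex of it and hence integral. -/

/-- The points satisfying `f i x ≤ b i` for all `i`, with equality for `i ∈ S`. -/
def face {E ι : Type*} [AddCommGroup E] [Module ℝ E] (f : ι → E →ₗ[ℝ] ℝ) (b : ι → ℝ)
    (S : Set ι) : Set E :=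
  {x | (∀ i, f i x ≤ b i) ∧ ∀ i ∈ S, f i x = b i}

theorem isClosed_face {E ι : Type*} [NormedAddCommGroup E] [NormedSpace ℝ E]
    [FiniteDimensional ℝ E] (f : ι → E →ₗ[ℝ] ℝ) (b : ι → ℝ) (S : Set ι) :
    IsClosed (face f b S) := by
  have hc := fun i => (f i).continuous_of_finiteDimensional
  simp only [face, Set.ofPred_and, Set.ofPred_forall]
  exact (isClosed_iInter fun i => isClosed_le (hc i) continuous_const).inter
    (isClosed_iInter fun i => isClosed_iInter fun _ => isClosed_eq (hc i) continuous_const)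

/-! ### Bounded part plus recession cone -/

section Decomposition

variable {E ι : Type*} [NormedAddCommGroup E] [NormedSpace ℝ E] [FiniteDimensional ℝ E]

/-- Normalised points of an unbounded sequence accumulate on the unit sphere, while the rescaled
right-hand sides tend to 0. -/
theorem exists_recession_direction (f : ι → E →ₗ[ℝ] ℝ) (b : ι → ℝ) (S : Set ι)
    (h : ∀ M : ℝ, ∃ x ∈ face f b S, M < ‖x‖) :
    ∃ d ∈ face f 0 S, d ≠ 0 := by
  have : ProperSpace E := FiniteDimensional.proper ℝ E
  choose x hx hlt using fun k : ℕ => h k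
  have hpos : ∀ k, 0 < ‖x k‖ := fun k => (Nat.cast_nonneg k).trans_lt (hlt k)
  have hu : ∀ k, ‖x k‖⁻¹ • x k ∈ Metric.sphere (0 : E) 1 := fun k => by
    rw [mem_sphere_zero_iff_norm, norm_smul, norm_inv, norm_norm, inv_mul_cancel₀ (hpos k).ne']
  obtain ⟨d, hd, φ, hφ, hlim⟩ := (isCompact_sphere (0 : E) 1).tendsto_subseq hu
  have hinf : Filter.Tendsto (fun k => ‖x k‖) Filter.atTop Filter.atTop :=
    Filter.tendsto_atTop_mono (fun k => (hlt k).le) tendsto_natCast_atTop_atTop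
  have hb : ∀ i, Filter.Tendsto (fun k => ‖x (φ k)‖⁻¹ * b i) Filter.atTop (nhds 0) := fun i => by
    simpa using ((tendsto_inv_atTop_zero.comp hinf).comp hφ.tendsto_atTop).mul_const (b i)
  have hf : ∀ i, Filter.Tendsto (fun k => ‖x (φ k)‖⁻¹ * f i (x (φ k))) Filter.atTop
      (nhds (f i d)) := fun i => by
    have := ((f i).continuous_of_finiteDimensional.tendsto d).comp hlim
    simpa [Function.comp_def] using this
  refine ⟨d, ⟨fun i => ?_, fun i hi => ?_⟩, ?_⟩
  · exact le_of_tendsto_of_tendsto' (hf i) (hb i) fun k =>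
      mul_le_mul_of_nonneg_left ((hx (φ k)).1 i) (inv_nonneg.2 (norm_nonneg _))
  · refine tendsto_nhds_unique (hf i) ?_
    simpa only [(hx _).2 i hi, Pi.zero_apply] using hb i
  · rintro rfl
    simp at hd

/-- Walking backwards along a recession direction makes a further constraint tight; induct on the
enlarged tight set, with bounded faces as base case. -/
theorem exists_bounded_remainder_of_pointed [Finite ι] (f : ι → E →ₗ[ℝ] ℝ) (b : ι → ℝ)
    (hf : ∀ x, (∀ i, f i x = 0) → x = 0) (S : Set ι) :
    ∃ M : ℝ, ∀ x ∈ face f b S, ∃ y ∈ face f 0 S, x - y ∈ face f b S ∧ ‖x - y‖ ≤ M := by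
  induction S using (wellFounded_gt : WellFounded ((· > ·) : Set ι → Set ι → Prop)).induction with
  | _ S ih =>
  by_cases hS : ∀ M : ℝ, ∃ x ∈ face f b S, M < ‖x‖
  · obtain ⟨d, hd, hd0⟩ := exists_recession_direction f b S hS
    -- The junk value 0 for `j ∈ S` lets one bound be chosen for every index and maximised over the
    -- finite type.
    have ih' : ∀ j, ∃ M : ℝ, j ∉ S → ∀ x ∈ face f b (insert j S), ∃ y ∈ face f 0 (insert j S),
        x - y ∈ face f b (insert j S) ∧ ‖x - y‖ ≤ M := fun j => by
      by_cases hj : j ∈ S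
      · exact ⟨0, fun h => (h hj).elim⟩
      · obtain ⟨M, hM⟩ := ih (insert j S) (Set.ssubset_insert hj)
        exact ⟨M, fun _ => hM⟩
    choose M hM using ih'
    obtain ⟨N, hN⟩ := (Set.finite_range M).bddAbove
    refine ⟨N, fun x hx => ?_⟩
    have hne : {i | f i d < 0}.Nonempty := by
      by_contra hcon
      rw [Set.not_nonempty_iff_eq_empty, Set.eq_empty_iff_forall_notMem] at hcon
      exact hd0 (hf d fun i => le_antisymm (hd.1 i) (not_lt.1 (hcon i)))
    obtain ⟨j, hj, hmin⟩ := Set.exists_min_image {i | f i d < 0}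
      (fun i => (b i - f i x) / (-f i d)) (Set.toFinite _) hne
    -- The largest step for which `x - t • d` stays feasible.
    set t := (b j - f j x) / (-f j d) with ht
    have hj' : f j d < 0 := hj
    have hjS : j ∉ S := fun h => hj'.ne (hd.2 j h)
    have ht0 : 0 ≤ t := div_nonneg (sub_nonneg.2 (hx.1 j)) (by linarith)
    have hmem : x - t • d ∈ face f b (insert j S) := by
      refine ⟨fun i => ?_, fun i hi => ?_⟩
      · rw [map_sub, map_smul, smul_eq_mul]
        rcases (hd.1 i).lt_or_eq with h | h
        · have h' : f i d < 0 := h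
          have := hmin i h
          rw [le_div_iff₀ (by linarith)] at this
          linarith
        · have h' : f i d = 0 := h
          rw [h', mul_zero, sub_zero]
          exact hx.1 i
      · rw [map_sub, map_smul, smul_eq_mul]
        rcases hi with rfl | hi
        · have : t * -f i d = b i - f i x := div_mul_cancel₀ _ (by linarith)
          linarith
        · have h' : f i d = 0 := hd.2 i hi
          rw [h', mul_zero, sub_zero]
          exact hx.2 i hi
    obtain ⟨y, hy, hxy, hle⟩ := hM j hjS _ hmem
    refine ⟨t • d + y, ⟨fun i => ?_, fun i hi => ?_⟩, ?_, ?_⟩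
    · have h1 : f i d ≤ 0 := hd.1 i
      have h2 : f i y ≤ 0 := hy.1 i
      simp only [map_add, map_smul, smul_eq_mul, Pi.zero_apply]
      nlinarith
    · have h1 : f i d = 0 := hd.2 i hi
      have h2 : f i y = 0 := hy.2 i (Or.inr hi)
      simp [h1, h2]
    · rw [← sub_sub]
      exact ⟨hxy.1, fun i hi => hxy.2 i (Or.inr hi)⟩
    · rw [← sub_sub]
      exact hle.trans (hN ⟨j, rfl⟩)
  · push Not at hS
    obtain ⟨M, hM⟩ := hS
    exact ⟨M, fun x hx => ⟨0, by simp [face], by simpa using hx, by simpa using hM x hx⟩⟩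

/-- Every face of a polyhedron is the sum of a bounded part and its recession cone. -/
theorem exists_bounded_remainder [Finite ι] (f : ι → E →ₗ[ℝ] ℝ) (b : ι → ℝ) (S : Set ι) :
    ∃ M : ℝ, ∀ x ∈ face f b S, ∃ y ∈ face f 0 S, x - y ∈ face f b S ∧ ‖x - y‖ ≤ M := by
  -- A complement of the lineality space is pointed; the lineality component goes into `y`.
  obtain ⟨K, hK⟩ := Submodule.exists_isCompl (⨅ i, LinearMap.ker (f i))
  obtain ⟨M, hM⟩ := exists_bounded_remainder_of_pointed (fun i => (f i).comp K.subtype) b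
    (fun x hx => by
      have h : (x : E) ∈ (⨅ i, LinearMap.ker (f i)) ⊓ K :=
        ⟨by simpa [Submodule.mem_iInf] using hx, x.2⟩
      rw [hK.inf_eq_bot] at h
      exact Subtype.ext h) S
  refine ⟨M, fun x hx => ?_⟩
  obtain ⟨z, hz, k, hk, rfl⟩ := Submodule.mem_sup.1
    (hK.sup_eq_top ▸ Submodule.mem_top : x ∈ (⨅ i, LinearMap.ker (f i)) ⊔ K)
  have hz' : ∀ i, f i z = 0 := by simpa [Submodule.mem_iInf] using hz
  obtain ⟨y, hy, hky, hle⟩ := hM ⟨k, hk⟩ (by simpa [face, hz'] using hx)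
  refine ⟨z + y, by simpa [face, hz'] using hy, ?_, ?_⟩
  · simpa [face, hz'] using hky
  · rw [add_sub_add_left_eq_sub]
    exact hle

theorem exists_max_on_face [Finite ι] (f : ι → E →ₗ[ℝ] ℝ) (b : ι → ℝ) (S : Set ι)
    (hne : (face f b S).Nonempty) (j : ι) :
    ∃ x ∈ face f b S, ∀ y ∈ face f b S, f j y ≤ f j x := by
  have : ProperSpace E := FiniteDimensional.proper ℝ E
  obtain ⟨M, hM⟩ := exists_bounded_remainder f b S
  have hcpt : IsCompact (face f b S ∩ Metric.closedBall 0 M) :=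
    (isCompact_closedBall 0 M).inter_left (isClosed_face f b S)
  obtain ⟨x₀, hx₀⟩ := hne
  obtain ⟨y₀, -, h1, h2⟩ := hM x₀ hx₀
  obtain ⟨x, hx, hmax⟩ := hcpt.exists_isMaxOn ⟨x₀ - y₀, h1, by simpa using h2⟩
    (f j).continuous_of_finiteDimensional.continuousOn
  refine ⟨x, hx.1, fun y hy => ?_⟩
  obtain ⟨d, hd, hyd, hle⟩ := hM y hy
  have h3 : f j (y - d) ≤ f j x := hmax ⟨hyd, by simpa using hle⟩
  have h4 : f j d ≤ 0 := hd.1 j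
  rw [map_sub] at h3
  linarith

end Decomposition

/-! ### Faces and convex hulls -/

theorem mem_convexHull_inter_of_le {E : Type*} [AddCommGroup E] [Module ℝ E] (g : E →ₗ[ℝ] ℝ)
    (β : ℝ) (T : Set E) (hT : ∀ z ∈ T, g z ≤ β) {y : E} (hy : y ∈ convexHull ℝ T)
    (hgy : g y = β) : y ∈ convexHull ℝ (T ∩ {z | g z = β}) := by
  have hsub : convexHull ℝ T ⊆ {z | g z ≤ β ∧ (g z = β → z ∈ convexHull ℝ (T ∩ {z | g z = β}))} := by
    refine convexHull_min (fun z hz => ⟨hT z hz, fun h => subset_convexHull _ _ ⟨hz, h⟩⟩) ?_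
    rw [convex_iff_forall_pos]
    rintro p ⟨hp, hp'⟩ q ⟨hq, hq'⟩ s t hs ht hst
    obtain rfl : s = 1 - t := by linarith
    refine ⟨?_, fun h => ?_⟩
    · simp only [map_add, map_smul, smul_eq_mul]
      nlinarith
    · simp only [map_add, map_smul, smul_eq_mul] at h
      exact convex_convexHull ℝ _ (hp' (by nlinarith)) (hq' (by nlinarith)) hs.le ht.le hst
  exact (hsub hy).2 hgy

/-- Successively maximising the functionals in `S` over a polyhedron leads to a nonempty face on
which all of them are constant. -/
theorem exists_face {E ι : Type*} [NormedAddCommGroup E] [NormedSpace ℝ E]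
    [FiniteDimensional ℝ E] [Finite ι] (f : ι → E →ₗ[ℝ] ℝ) (b : ι → ℝ)
    (hne : (face f b ∅).Nonempty) (S : Set ι) :
    ∃ c : ι → ℝ, (face f c S).Nonempty ∧ face f c S ⊆ face f b ∅ ∧
      ∀ T ⊆ face f b ∅, ∀ y ∈ face f c S, y ∈ convexHull ℝ T →
        y ∈ convexHull ℝ (T ∩ face f c S) := by
  classical
  induction S, Set.toFinite S using Set.Finite.induction_on with
  | empty =>
    refine ⟨b, hne, subset_rfl, fun T hT y _ hyT => ?_⟩
    rwa [Set.inter_eq_left.2 hT]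
  | @insert j S hj _ ih =>
    obtain ⟨c, hc, hcb, hhull⟩ := ih
    obtain ⟨x, hx, hmax⟩ := exists_max_on_face f c S hc j
    have heq : face f (Function.update c j (f j x)) (insert j S) =
        face f c S ∩ {z | f j z = f j x} := by
      ext z
      constructor
      · rintro ⟨h1, h2⟩
        have hjz : f j z = f j x := by simpa using h2 j (Or.inl rfl)
        refine ⟨⟨fun i => ?_, fun i hi => ?_⟩, hjz⟩
        · rcases eq_or_ne i j with rfl | hij
          · exact hjz.trans_le (hx.1 i)
          · simpa [hij] using h1 i
        · have hij : i ≠ j := fun h => hj (h ▸ hi)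
          simpa [hij] using h2 i (Or.inr hi)
      · rintro ⟨⟨h1, h2⟩, hjz⟩
        refine ⟨fun i => ?_, fun i hi => ?_⟩
        · rcases eq_or_ne i j with rfl | hij
          · simpa using (show f i z = f i x from hjz).le
          · simpa [hij] using h1 i
        · rcases eq_or_ne i j with rfl | hij
          · simpa using hjz
          · simpa [hij] using h2 i (hi.resolve_left hij)
    refine ⟨Function.update c j (f j x), ?_, ?_, ?_⟩
    · rw [heq]
      exact ⟨x, hx, rfl⟩
    · rw [heq]
      exact Set.inter_subset_left.trans hcb
    · rw [heq]
      rintro T hT y ⟨hy, hjy⟩ hyT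
      rw [← Set.inter_assoc]
      exact mem_convexHull_inter_of_le (f j) (f j x) _ (fun z hz => hmax z hz.2)
        (hhull T hT y hy hyT) hjy

/-! ### Box-integrality of the recession cone -/

theorem toReal_add {n : ℕ} (z w : Fin n → ℤ) : toReal (z + w) = toReal z + toReal w := by
  ext i
  simp [toReal]

theorem toReal_le_toReal {n : ℕ} {z w : Fin n → ℤ} : toReal z ≤ toReal w ↔ z ≤ w := by
  simp [toReal, Pi.le_def]

/-- All intersections with integral boxes are spanned by their integer points, without the
polyhedrality part. -/
def BoxIntegral {n : ℕ} (P : Set (Fin n → ℝ)) : Prop :=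
  ∀ l u : Fin n → ℤ,
    P ∩ Set.Icc (toReal l) (toReal u) ⊆
      convexHull ℝ (P ∩ Set.Icc (toReal l) (toReal u) ∩ integerPoints n)

/-- Translating by `-w` preserves only the equations in `S`, since `w` may have slack elsewhere;
hence the inequalities are dropped. -/
theorem mem_convexHull_of_boxIntegral {n : ℕ} {ι : Type*} [Finite ι]
    (f : ι → (Fin n → ℝ) →ₗ[ℝ] ℝ) (b : ι → ℝ) (hne : (face f b ∅).Nonempty)
    (hP : BoxIntegral (face f b ∅)) (S : Set ι) (l u : Fin n → ℤ) {v : Fin n → ℝ}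
    (hv : v ∈ face f 0 S) (hvb : v ∈ Set.Icc (toReal l) (toReal u)) :
    v ∈ convexHull ℝ ({x | ∀ i ∈ S, f i x = 0} ∩ Set.Icc (toReal l) (toReal u) ∩
      integerPoints n) := by
  obtain ⟨c, ⟨y, hy⟩, hcb, hhull⟩ := exists_face f b hne S
  have hybox : y ∈ Set.Icc (toReal fun i => ⌊y i⌋) (toReal fun i => ⌈y i⌉) :=
    ⟨fun i => Int.floor_le _, fun i => Int.le_ceil _⟩
  obtain ⟨_, ⟨-, w, rfl⟩, hw⟩ := convexHull_nonempty_iff.1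
    ⟨y, hhull _ (Set.inter_subset_left.trans Set.inter_subset_left) y hy
      (hP _ _ ⟨hcb hy, hybox⟩)⟩
  have hwv : toReal w + v ∈ face f c S := by
    refine ⟨fun i => ?_, fun i hi => ?_⟩
    · have h1 : f i v ≤ 0 := hv.1 i
      have h2 := hw.1 i
      rw [map_add]
      linarith
    · have h1 : f i v = 0 := hv.2 i hi
      rw [map_add, h1, add_zero, hw.2 i hi]
  have hbox : toReal w + v ∈ Set.Icc (toReal (w + l)) (toReal (w + u)) := by
    rw [toReal_add, toReal_add]
    exact ⟨add_le_add_right hvb.1 _, add_le_add_right hvb.2 _⟩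
  have hmem := hhull _ (Set.inter_subset_left.trans Set.inter_subset_left) _ hwv
    (hP _ _ ⟨hcb hwv, hbox⟩)
  have key : convexHull ℝ (face f b ∅ ∩ Set.Icc (toReal (w + l)) (toReal (w + u)) ∩
      integerPoints n ∩ face f c S) ⊆ (fun z => z + -toReal w) ⁻¹'
        convexHull ℝ ({x | ∀ i ∈ S, f i x = 0} ∩ Set.Icc (toReal l) (toReal u) ∩
          integerPoints n) := by
    refine convexHull_min ?_ ((convex_convexHull ℝ _).translate_preimage_left _)
    rintro _ ⟨⟨⟨-, hz1, hz2⟩, z, rfl⟩, hz⟩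
    rw [toReal_le_toReal] at hz1 hz2
    have hzw : toReal z + -toReal w = toReal (z - w) := by
      ext i
      simp [toReal, sub_eq_add_neg]
    refine subset_convexHull _ _ ⟨⟨fun i hi => ?_, ?_⟩, ?_⟩
    · rw [map_add, map_neg, hz.2 i hi, hw.2 i hi, add_neg_cancel]
    · beta_reduce
      rw [hzw, Set.mem_Icc, toReal_le_toReal, toReal_le_toReal]
      exact ⟨le_sub_iff_add_le'.2 hz1, sub_le_iff_le_add'.2 hz2⟩
    · beta_reduce
      rw [hzw]
      exact ⟨_, rfl⟩
  simpa using key hmem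

/-- A point of a cone can be moved a little towards any point on which the tight constraints
vanish. -/
theorem exists_lineMap_mem_cone {E ι : Type*} [AddCommGroup E] [Module ℝ E] [Finite ι]
    (f : ι → E →ₗ[ℝ] ℝ) {v x : E} (hv : v ∈ face f 0 ∅) (hx : ∀ i, f i v = 0 → f i x = 0) :
    ∃ ε : ℝ, 0 < ε ∧ ∀ t, 0 ≤ t → t ≤ ε → AffineMap.lineMap v x t ∈ face f 0 ∅ := by
  have h : ∀ᶠ t : ℝ in nhds 0, ∀ i, (1 - t) * f i v + t * f i x ≤ 0 := by
    rw [Filter.eventually_all]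
    intro i
    rcases (hv.1 i).lt_or_eq with h | h
    · have hc : ContinuousAt (fun t : ℝ => (1 - t) * f i v + t * f i x) 0 := by fun_prop
      have h' : f i v < 0 := h
      exact (hc.eventually_lt continuousAt_const (by simpa using h')).mono fun _ => le_of_lt
    · have h' : f i v = 0 := h
      simp [h', hx i h']
  obtain ⟨ε, hε, hball⟩ := Metric.eventually_nhds_iff.1 h
  refine ⟨ε / 2, half_pos hε, fun t ht htε => ⟨fun i => ?_, by simp⟩⟩
  have := hball (y := t) (by rw [Real.dist_0_eq_abs, abs_of_nonneg ht]; linarith) i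
  simpa [AffineMap.lineMap_apply_module] using this

theorem extremePoint_mem_integerPoints {n : ℕ} {ι : Type*} [Finite ι]
    (f : ι → (Fin n → ℝ) →ₗ[ℝ] ℝ) (b : ι → ℝ) (hne : (face f b ∅).Nonempty)
    (hP : BoxIntegral (face f b ∅)) (l u : Fin n → ℤ) {v : Fin n → ℝ}
    (hv : v ∈ (face f 0 ∅ ∩ Set.Icc (toReal l) (toReal u)).extremePoints ℝ) :
    v ∈ integerPoints n := by
  obtain ⟨⟨hvC, hvb⟩, hext⟩ := mem_extremePoints.1 hv
  set S : Set ι := {i | f i v = 0} with hS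
  set K := {x : Fin n → ℝ | ∀ i ∈ S, f i x = 0} ∩ Set.Icc (toReal l) (toReal u) with hK
  have hconv : v ∈ convexHull ℝ (K ∩ integerPoints n) :=
    mem_convexHull_of_boxIntegral f b hne hP S l u ⟨hvC.1, fun i hi => hi⟩ hvb
  have hvK : v ∈ K.extremePoints ℝ := by
    rw [mem_extremePoints]
    refine ⟨⟨fun i hi => hi, hvb⟩, fun x hx y hy hxy => ?_⟩
    obtain ⟨ε, hε, hεx⟩ := exists_lineMap_mem_cone f hvC hx.1
    obtain ⟨δ, hδ, hδy⟩ := exists_lineMap_mem_cone f hvC hy.1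
    -- `t ≤ 1` keeps the shrunken segment in the box, `t ≤ ε` and `t ≤ δ` in the cone.
    set t := min 1 (min ε δ) with ht
    have ht0 : 0 < t := lt_min one_pos (lt_min hε hδ)
    have ht1 : t ≤ 1 := min_le_left _ _
    have htε : t ≤ ε := (min_le_right _ _).trans (min_le_left _ _)
    have htδ : t ≤ δ := (min_le_right _ _).trans (min_le_right _ _)
    have hbox : ∀ z ∈ Set.Icc (toReal l) (toReal u),
        AffineMap.lineMap v z t ∈ Set.Icc (toReal l) (toReal u) := fun z hz =>
      (convex_Icc _ _).lineMap_mem hvb hz ⟨ht0.le, ht1⟩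
    have hseg : v ∈ openSegment ℝ (AffineMap.lineMap v x t) (AffineMap.lineMap v y t) := by
      obtain ⟨p, q, hp, hq, hpq, h⟩ := hxy
      refine ⟨p, q, hp, hq, hpq, ?_⟩
      calc p • AffineMap.lineMap v x t + q • AffineMap.lineMap v y t
          = ((1 - t) * (p + q)) • v + t • (p • x + q • y) := by
            simp only [AffineMap.lineMap_apply_module]
            module
        _ = v := by
            rw [hpq, h]
            module
    obtain ⟨h1, h2⟩ := hext _ ⟨hεx t ht0.le htε, hbox x hx.2⟩ _ ⟨hδy t ht0.le htδ, hbox y hy.2⟩ hseg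
    have cancel : ∀ z : Fin n → ℝ, AffineMap.lineMap v z t = v → z = v := fun z hz => by
      rw [AffineMap.lineMap_eq_left_iff] at hz
      exact (hz.resolve_right ht0.ne').symm
    exact ⟨cancel x h1, cancel y h2⟩
  have hKconv : Convex ℝ K := by
    refine Convex.inter (fun x hx y hy p q _ _ _ i hi => ?_) (convex_Icc _ _)
    simp [hx i hi, hy i hi]
  have hsub : convexHull ℝ (K ∩ integerPoints n) ⊆ K :=
    convexHull_min Set.inter_subset_left hKconv
  exact (extremePoints_convexHull_subset
    (inter_extremePoints_subset_extremePoints_of_subset hsub ⟨hconv, hvK⟩)).2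

theorem finite_integerPoints_Icc {n : ℕ} (l u : Fin n → ℤ) :
    (Set.Icc (toReal l) (toReal u) ∩ integerPoints n).Finite := by
  refine ((Set.finite_Icc l u).image toReal).subset ?_
  rintro _ ⟨⟨h1, h2⟩, z, rfl⟩
  exact ⟨z, ⟨toReal_le_toReal.1 h1, toReal_le_toReal.1 h2⟩, rfl⟩

theorem convex_face {E ι : Type*} [AddCommGroup E] [Module ℝ E] (f : ι → E →ₗ[ℝ] ℝ)
    (b : ι → ℝ) (S : Set ι) : Convex ℝ (face f b S) := by
  simp only [face, Set.ofPred_and, Set.ofPred_forall]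
  exact (convex_iInter fun i => convex_halfSpace_le (f i).isLinear _).inter
    (convex_iInter fun i => convex_iInter fun _ => convex_hyperplane (f i).isLinear _)

/-- The recession cone of a box-integral polyhedron is box-integral. -/
theorem boxIntegral_recession {n : ℕ} {ι : Type*} [Finite ι]
    (f : ι → (Fin n → ℝ) →ₗ[ℝ] ℝ) (b : ι → ℝ) (hne : (face f b ∅).Nonempty)
    (hP : BoxIntegral (face f b ∅)) : BoxIntegral (face f 0 ∅) := by
  intro l u
  set B := face f 0 ∅ ∩ Set.Icc (toReal l) (toReal u) with hB
  have hcpt : IsCompact B := isCompact_Icc.inter_left (isClosed_face f 0 ∅)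
  have hconv : Convex ℝ B := (convex_face f 0 ∅).inter (convex_Icc _ _)
  have hfin : (B ∩ integerPoints n).Finite :=
    (finite_integerPoints_Icc l u).subset (Set.inter_subset_inter_left _ Set.inter_subset_right)
  -- Krein–Milman; the closure disappears because the integer points are finitely many.
  calc B = closure (convexHull ℝ (B.extremePoints ℝ)) :=
        (closure_convexHull_extremePoints hcpt hconv).symm
    _ ⊆ closure (convexHull ℝ (B ∩ integerPoints n)) :=
        closure_mono (convexHull_mono fun v hv =>
          ⟨hv.1, extremePoint_mem_integerPoints f b hne hP l u hv⟩)
    _ = _ := (hfin.isClosed_convexHull ℝ).closure_eq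

/-! ### Polyhedra, boxes and the characteristic cone -/

theorem isPolyhedron_face {n : ℕ} {ι : Type*} [Finite ι] (f : ι → (Fin n → ℝ) →ₗ[ℝ] ℝ)
    (b : ι → ℝ) : IsPolyhedron (face f b ∅) := by
  obtain ⟨m, ⟨e⟩⟩ := Finite.exists_equiv_fin ι
  refine ⟨m, LinearMap.toMatrix' (LinearMap.pi fun k => f (e.symm k)), fun k => b (e.symm k), ?_⟩
  ext x
  simp [face, Pi.le_def, e.symm.forall_congr_left]

theorem IsPolyhedron.exists_eq_face {n : ℕ} {P : Set (Fin n → ℝ)} (hP : IsPolyhedron P) :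
    ∃ (m : ℕ) (f : Fin m → (Fin n → ℝ) →ₗ[ℝ] ℝ) (b : Fin m → ℝ), P = face f b ∅ := by
  obtain ⟨m, A, b, rfl⟩ := hP
  refine ⟨m, fun i => LinearMap.proj i ∘ₗ A.mulVecLin, b, ?_⟩
  ext x
  simp [face, Pi.le_def]

theorem IsPolyhedron.inter {n : ℕ} {P R : Set (Fin n → ℝ)} (hP : IsPolyhedron P)
    (hR : IsPolyhedron R) : IsPolyhedron (P ∩ R) := by
  obtain ⟨k, f, b, rfl⟩ := hP.exists_eq_face
  obtain ⟨m, g, c, rfl⟩ := hR.exists_eq_face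
  convert isPolyhedron_face (Sum.elim f g) (Sum.elim b c) using 1
  ext x
  simp [face]

theorem isPolyhedron_Icc {n : ℕ} (l u : Fin n → ℝ) : IsPolyhedron (Set.Icc l u) := by
  convert isPolyhedron_face (Sum.elim (fun i => -LinearMap.proj i) fun i => LinearMap.proj i)
    (Sum.elim (-l) u) using 1
  ext x
  simp [face, Pi.le_def]

theorem isBoxIntegerPolyhedron_iff {n : ℕ} {P : Set (Fin n → ℝ)} :
    IsBoxIntegerPolyhedron P ↔ IsPolyhedron P ∧ BoxIntegral P := by
  refine ⟨fun h => ⟨h.1, fun l u => ?_⟩, fun h => ⟨h.1, fun l u _ => ⟨?_, ?_⟩⟩⟩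
  · by_cases hlu : l ≤ u
    · exact (h.2 l u hlu).2.subset
    -- Otherwise the box is empty, so `BoxIntegral` may omit `l ≤ u`; intersecting boxes can violate
    -- it.
    · rw [← toReal_le_toReal] at hlu
      simp [Set.Icc_eq_empty hlu]
  · exact h.1.inter (isPolyhedron_Icc _ _)
  · refine (h.2 l u).antisymm (convexHull_min Set.inter_subset_left ?_)
    obtain ⟨m, f, b, rfl⟩ := h.1.exists_eq_face
    exact (convex_face f b ∅).inter (convex_Icc _ _)

theorem BoxIntegral.inter_Icc {n : ℕ} {P : Set (Fin n → ℝ)} (hP : BoxIntegral P)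
    (l u : Fin n → ℤ) : BoxIntegral (P ∩ Set.Icc (toReal l) (toReal u)) := by
  intro l' u'
  have hsup : toReal (l ⊔ l') = toReal l ⊔ toReal l' := by
    ext i
    simp [toReal]
  have hinf : toReal (u ⊓ u') = toReal u ⊓ toReal u' := by
    ext i
    simp [toReal]
  rw [Set.inter_assoc, Set.Icc_inter_Icc, ← hsup, ← hinf]
  exact hP _ _

theorem charCone_face {n : ℕ} {ι : Type*} (f : ι → (Fin n → ℝ) →ₗ[ℝ] ℝ)
    (b : ι → ℝ) (hne : (face f b ∅).Nonempty) : charCone (face f b ∅) = face f 0 ∅ := by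
  ext d
  refine ⟨fun hd => ⟨fun i => ?_, by simp⟩, fun hd x hx => ⟨fun i => ?_, by simp⟩⟩
  · obtain ⟨x, hx⟩ := hne
    -- If `f i d > 0`, a large multiple of `d` would violate constraint `i`.
    have hk : ∀ k : ℕ, x + (k : ℝ) • d ∈ face f b ∅ := fun k => by
      induction k with
      | zero => simpa using hx
      | succ k ih =>
        rw [Nat.cast_succ, add_smul, one_smul, ← add_assoc]
        exact hd _ ih
    by_contra! hpos
    have hpos' : 0 < f i d := hpos
    obtain ⟨k, hk'⟩ := exists_nat_gt ((b i - f i x) / f i d)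
    rw [div_lt_iff₀ hpos'] at hk'
    have := (hk k).1 i
    rw [map_add, map_smul, smul_eq_mul] at this
    linarith
  · have h1 : f i d ≤ 0 := hd.1 i
    have h2 := hx.1 i
    rw [map_add]
    linarith

end Polyhedra

theorem theorem1 (n : ℕ) (P : Set (Fin n → ℝ)) (hne : P.Nonempty)
    (hP : Polyhedra.IsBoxIntegerPolyhedron P) :
    ∃ Q C : Set (Fin n → ℝ),
      (Q.Nonempty ∧ Polyhedra.IsBoxIntegerPolyhedron Q ∧ Bornology.IsBounded Q) ∧
      (C.Nonempty ∧ Polyhedra.IsBoxIntegerPolyhedron C ∧ Polyhedra.IsCone C) ∧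
      C = Polyhedra.charCone P ∧
      P = Q + C := by
  open Polyhedra in
  obtain ⟨hpoly, hbox⟩ := isBoxIntegerPolyhedron_iff.1 hP
  obtain ⟨m, f, b, rfl⟩ := hpoly.exists_eq_face
  obtain ⟨M, hM⟩ := exists_bounded_remainder f b ∅
  obtain ⟨N, hN⟩ := exists_nat_ge M
  have hmem : ∀ x : Fin n → ℝ, ‖x‖ ≤ M →
      x ∈ Set.Icc (toReal fun _ => -(N : ℤ)) (toReal fun _ => (N : ℤ)) := fun x hx => by
    have h : ∀ i, |x i| ≤ N := fun i => (norm_le_pi_norm x i).trans (hx.trans hN)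
    exact ⟨fun i => by simpa [toReal] using (abs_le.1 (h i)).1,
      fun i => by simpa [toReal] using (abs_le.1 (h i)).2⟩
  refine ⟨face f b ∅ ∩ Set.Icc (toReal fun _ => -(N : ℤ)) (toReal fun _ => (N : ℤ)), face f 0 ∅,
    ⟨?_, ?_, ?_⟩, ⟨⟨0, by simp [face]⟩, ?_, ?_⟩, (charCone_face f b hne).symm, ?_⟩
  · obtain ⟨x, hx⟩ := hne
    obtain ⟨y, -, h1, h2⟩ := hM x hx
    exact ⟨x - y, h1, hmem _ h2⟩
  · exact isBoxIntegerPolyhedron_iff.2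
      ⟨hpoly.inter (isPolyhedron_Icc _ _), hbox.inter_Icc _ _⟩
  · exact (Metric.isBounded_Icc _ _).subset Set.inter_subset_right
  · exact isBoxIntegerPolyhedron_iff.2
      ⟨isPolyhedron_face f 0, boxIntegral_recession f b hne hbox⟩
  · intro d hd t ht
    refine ⟨fun i => ?_, by simp⟩
    rw [map_smul]
    exact mul_nonpos_of_nonneg_of_nonpos ht (hd.1 i)
  · ext x
    constructor
    · intro hx
      obtain ⟨y, hy, h1, h2⟩ := hM x hx
      exact Set.mem_add.2 ⟨x - y, ⟨h1, hmem _ h2⟩, y, hy, sub_add_cancel x y⟩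
    · rintro ⟨q, hq, d, hd, rfl⟩
      rw [← charCone_face f b hne] at hd
      exact hd q hq.1
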